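/- **Theorem (label lower bound for active learning of decision stumps).** Let $X=(X_1<\dots<X_n)$ be a dataset of $n$ distinct real points with hidden labels $Y\in\{0,1\}^n$. A decision stump is a classifier $x\mapsto \mathbb I(x\ge t)$ with a threshold $t$; on $X$ there are $n+1$ of them, labeling by $1$ exactly the points from some index on (possibly all points or none). The error $\mathrm{err}_Y(h)$ is the fraction of data points on which $h$ differs from $Y$, and $h$ is $(1+\epsilon)$-approximate if $\mathrm{err}_Y(h)\le(1+\epsilon)\min_{h'}\mathrm{err}_Y(h')$, the minimum being over all stumps. A (randomized) active learning algorithm knows $X$, adaptively queries labels of points of its choice, and returns a stump. There is a universal constant $c>0$ such that for all $\epsilon>0$ and $\delta\in(0,1)$ the following holds for all sufficiently large $n$ (depending on $\epsilon,\delta$ only). On every dataset $X$ of $n$ points, every active learning algorithm which, for every labeling $Y$, returns a $(1+\epsilon)$-approximate stump with probability greater than $1-\delta$ makes in the worst case at least $$c\,\frac{\ln(1/\delta)}{\epsilon^2}$$ label queries, i.e. for some labeling $Y$ it makes at least that many queries with positive probability. Moreover, there is a universal constant $C>0$ such that, for $0<\epsilon\le 1$ and $0<\delta\le\frac14$, this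 conclusion (with the same $c$) holds for every $n\ge C\,\frac{1}{\epsilon^2}\ln\frac{1}{\epsilon\delta}$. -/

import Mathlib

open MeasureTheory

/-- A deterministic active learner for a dataset of `n` unlabeled points, which it knows in advance:
an adaptive strategy that either queries the label of a point `i` and continues according to the
answer, or stops and returns a decision stump, represented by an index in `{0, ..., n}`
(see `stump`). -/
inductive ActiveLearner (n : ℕ) : Type
  | output (h : Fin (n + 1)) : ActiveLearner n
  | query (i : Fin n) (ifZero ifOne : ActiveLearner n) : ActiveLearner n

namespace ActiveLearner

/-- The stump returned when the hidden labels are `Y`. -/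
def run {n : ℕ} : ActiveLearner n → (Fin n → Bool) → Fin (n + 1)
  | output h, _ => h
  | query i T₀ T₁, Y => if Y i then T₁.run Y else T₀.run Y

/-- The number of label queries made when the hidden labels are `Y`. -/
def queries {n : ℕ} : ActiveLearner n → (Fin n → Bool) → ℕ
  | output _, _ => 0
  | query i T₀ T₁, Y => 1 + if Y i then T₁.queries Y else T₀.queries Y

/-- There are only countably many deterministic learners, and every set of them is an event. A
randomized active learner is a probability measure on this space: the internal randomness is drawn
first and then determines the adaptive strategy. -/
instance (n : ℕ) : MeasurableSpace (ActiveLearner n) := ⊤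

end ActiveLearner

/-- The threshold of the stump with index `h`: the point `X h` if `h < n`, and `+∞` if `h = n`. -/
noncomputable def stumpThreshold {n : ℕ} (X : Fin n → ℝ) (h : Fin (n + 1)) : EReal :=
  if hn : h.val < n then ((X ⟨h.val, hn⟩ : ℝ) : EReal) else ⊤

/-- The decision stump with index `h`: it labels `x` by `1` iff `x` is at least the threshold. For
sorted `X`, `h` is the (zero-based) index of the first data point labeled `1`; `h = 0` labels all
data points by `1` and `h = n` labels none of them by `1`. -/
noncomputable def stump {n : ℕ} (X : Fin n → ℝ) (h : Fin (n + 1)) (x : ℝ) : Bool :=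
  decide (stumpThreshold X h ≤ (x : EReal))

/-- The error rate of the stump `h`: the fraction of data points that it misclassifies. -/
noncomputable def stumpErr {n : ℕ} (X : Fin n → ℝ) (Y : Fin n → Bool) (h : Fin (n + 1)) : ℝ :=
  (1 / (n : ℝ)) * ∑ i : Fin n, if stump X h (X i) ≠ Y i then (1 : ℝ) else 0

/-- `h` is a `(1 + ε)`-approximate stump: its error is at most `1 + ε` times that of every stump,
in particular that of an optimal one. -/
def IsApproxStump {n : ℕ} (X : Fin n → ℝ) (Y : Fin n → Bool) (ε : ℝ) (h : Fin (n + 1)) : Prop :=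
  ∀ h' : Fin (n + 1), stumpErr X Y h ≤ (1 + ε) * stumpErr X Y h'

/-- The randomized active learner `A` on the dataset `X` returns, whatever the labels are, a
`(1 + ε)`-approximate stump with probability greater than `1 - δ`. -/
def LearnsStump {n : ℕ} (X : Fin n → ℝ) (ε δ : ℝ) (A : Measure (ActiveLearner n)) : Prop :=
  ∀ Y : Fin n → Bool, 1 - δ < A.real {T | IsApproxStump X Y ε (T.run Y)}

/-- On every sorted dataset of `n` distinct points, every randomized active learner that returns a
`(1 + ε)`-approximate stump with probability greater than `1 - δ` has worst-case query number at
least `m`: for some labels it makes at least `m` queries with positive probability. -/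
def StumpLearningRequires (n : ℕ) (ε δ m : ℝ) : Prop :=
  ∀ X : Fin n → ℝ, StrictMono X →
    ∀ A : Measure (ActiveLearner n), IsProbabilityMeasure A → LearnsStump X ε δ A →
      ∃ Y : Fin n → Bool, 0 < A {T | m ≤ (T.queries Y : ℝ)}

/-! For fixed `ε`, `δ` and all large `n`, counting suffices: each stump is the only approximate one
for its own labels, while `q` queries lead to at most `2 ^ q` outputs (`card_image_run_le`).

The quantitative bound tests a hidden bit `b`. The labels are independent and equal `b` with
probability `1 / 2 + γ`, where `γ` is of order `ε`. The constant stump `b` then beats every stump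
disagreeing with `b` on half the points by more than the factor `1 + ε`, up to a probability
exponentially small in `n * ε ^ 2` (`prodExp_isApproxStump_le`). A union bound over the `n + 1`
stumps allows for the output depending on the labels, so a successful learner reveals `b` with error
of order `δ`.

Against this, one label has Hellinger affinity `√(1 - 4 * γ ^ 2)` between the two values of `b`.
Conditioning on an answer leaves a product distribution, so affinity drops at most by this factor
per adaptive query (`pow_le_affinity`). Small error forces small affinity (`sq_affinity_le`), and
taking logarithms bounds the number of queries. Randomized learners reduce to deterministic ones by
averaging over the labels (`exists_learner_of_learnsStump`). -/

/-! ### Product distributions on labelings -/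

/-- The expectation of `f` when the labels are independent, the `i`-th with weights `μ i`. -/
def prodExp {ι : Type*} [Fintype ι] [DecidableEq ι] (μ : ι → Bool → ℝ) (f : (ι → Bool) → ℝ) : ℝ :=
  ∑ Y : ι → Bool, (∏ i, μ i (Y i)) * f Y

section prodExp

variable {ι : Type*} [Fintype ι] [DecidableEq ι] {μ : ι → Bool → ℝ}

theorem prodExp_mono (hμ : ∀ i y, 0 ≤ μ i y) {f g : (ι → Bool) → ℝ} (h : ∀ Y, f Y ≤ g Y) :
    prodExp μ f ≤ prodExp μ g :=
  Finset.sum_le_sum fun Y _ =>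
    mul_le_mul_of_nonneg_left (h Y) (Finset.prod_nonneg fun i _ => hμ i (Y i))

theorem prodExp_nonneg (hμ : ∀ i y, 0 ≤ μ i y) {f : (ι → Bool) → ℝ} (h : ∀ Y, 0 ≤ f Y) :
    0 ≤ prodExp μ f :=
  Finset.sum_nonneg fun Y _ => mul_nonneg (Finset.prod_nonneg fun i _ => hμ i (Y i)) (h Y)

theorem prodExp_prod (g : ι → Bool → ℝ) :
    prodExp μ (fun Y => ∏ i, g i (Y i)) = ∏ i, ∑ y, μ i y * g i y := by
  rw [Finset.prod_univ_sum, Fintype.piFinset_univ]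
  simp only [prodExp, Finset.prod_mul_distrib]

theorem prodExp_const (hμ : ∀ i, ∑ y, μ i y = 1) (a : ℝ) : prodExp μ (fun _ => a) = a := by
  have h := prodExp_prod (μ := μ) (fun _ _ => 1)
  simp only [Finset.prod_const_one, mul_one, hμ] at h
  simp only [prodExp, mul_one] at h ⊢
  rw [← Finset.sum_mul, h, one_mul]

theorem prodExp_add (f g : (ι → Bool) → ℝ) :
    prodExp μ (fun Y => f Y + g Y) = prodExp μ f + prodExp μ g := by
  simp only [prodExp, mul_add, Finset.sum_add_distrib]

theorem prodExp_sum {κ : Type*} (s : Finset κ) (f : κ → (ι → Bool) → ℝ) :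
    prodExp μ (fun Y => ∑ k ∈ s, f k Y) = ∑ k ∈ s, prodExp μ (f k) := by
  simp only [prodExp, Finset.mul_sum]
  exact Finset.sum_comm

/-- Conditioning on the label of `i`. -/
theorem prodExp_eq_sum_update (i : ι) (f : (ι → Bool) → ℝ) (g : Bool → (ι → Bool) → ℝ)
    (hfg : ∀ Y, f Y = g (Y i) Y) :
    prodExp μ f = ∑ y, μ i y * prodExp (Function.update μ i (Pi.single y 1)) (g y) := by
  simp only [prodExp, Finset.mul_sum]
  rw [Finset.sum_comm]
  refine Finset.sum_congr rfl fun Y _ => ?_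
  rw [Finset.sum_eq_single (Y i)]
  · rw [hfg, ← mul_assoc]
    congr 1
    rw [← Finset.mul_prod_erase _ _ (Finset.mem_univ i),
      ← Finset.mul_prod_erase _ (fun j => Function.update μ i (Pi.single (Y i) 1) j (Y j))
        (Finset.mem_univ i)]
    simp only [Function.update_self, Pi.single_eq_same, one_mul]
    congr 1
    refine Finset.prod_congr rfl fun j hj => ?_
    rw [Function.update_of_ne (Finset.ne_of_mem_erase hj)]
  · intro y _ hy
    have : ∏ j, Function.update μ i (Pi.single y 1) j (Y j) = 0 :=
      Finset.prod_eq_zero (Finset.mem_univ i) (by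
        rw [Function.update_self, Pi.single_eq_of_ne hy.symm])
    rw [this, zero_mul, mul_zero]
  · simp

/-- A Chernoff bound for sums of independent bounded variables. -/
theorem prodExp_sum_nonpos_le (hμ : ∀ i y, 0 ≤ μ i y) (hμ1 : ∀ i, ∑ y, μ i y = 1)
    (v : ι → Bool → ℝ) (hv : ∀ i y, |v i y| ≤ 2) {l : ℝ} (hl : 0 ≤ l) (hl2 : l ≤ 1 / 2) :
    prodExp μ (fun Y => if ∑ i, v i (Y i) ≤ 0 then 1 else 0) ≤
      Real.exp (4 * l ^ 2 * Fintype.card ι - l * ∑ i, ∑ y, μ i y * v i y) := by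
  have h1 : prodExp μ (fun Y => if ∑ i, v i (Y i) ≤ 0 then 1 else 0) ≤
      prodExp μ (fun Y => ∏ i, Real.exp (-l * v i (Y i))) := by
    refine prodExp_mono hμ fun Y => ?_
    rw [← Real.exp_sum, ← Finset.mul_sum]
    split_ifs with h
    · exact Real.one_le_exp (mul_nonneg_of_nonpos_of_nonpos (by linarith) h)
    · exact (Real.exp_pos _).le
  refine h1.trans ?_
  rw [prodExp_prod (fun i y => Real.exp (-l * v i y))]
  have h2 : ∀ i, ∑ y, μ i y * Real.exp (-l * v i y) ≤
      Real.exp (4 * l ^ 2 - l * ∑ y, μ i y * v i y) := by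
    intro i
    -- Second-order bound `exp x ≤ 1 + x + x ^ 2` for `|x| ≤ 1`; this is where `l ≤ 1 / 2` is
    -- needed.
    have h3 : ∀ y, Real.exp (-l * v i y) ≤ 1 - l * v i y + 4 * l ^ 2 := by
      intro y
      have hb := hv i y
      have h4 : |-l * v i y| ≤ 1 := by
        rw [abs_mul, abs_neg, abs_of_nonneg hl]
        nlinarith [abs_nonneg (v i y)]
      have h5 := (abs_le.1 (Real.abs_exp_sub_one_sub_id_le h4)).2
      have h6 : v i y ^ 2 ≤ 4 := by
        rw [← sq_abs]; nlinarith [abs_nonneg (v i y)]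
      nlinarith [mul_le_mul_of_nonneg_left h6 (sq_nonneg l)]
    calc ∑ y, μ i y * Real.exp (-l * v i y)
        ≤ ∑ y, μ i y * (1 - l * v i y + 4 * l ^ 2) :=
          Finset.sum_le_sum fun y _ => mul_le_mul_of_nonneg_left (h3 y) (hμ i y)
      _ = (4 * l ^ 2 - l * ∑ y, μ i y * v i y) + 1 := by
          have := hμ1 i
          simp only [Fintype.sum_bool] at this ⊢
          linear_combination (1 + 4 * l ^ 2) * this
      _ ≤ _ := Real.add_one_le_exp _
  refine (Finset.prod_le_prod (fun i _ => Finset.sum_nonneg fun y _ =>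
    mul_nonneg (hμ i y) (Real.exp_pos _).le) (fun i _ => h2 i)).trans_eq ?_
  rw [← Real.exp_sum]
  congr 1
  rw [Finset.sum_sub_distrib, Finset.sum_const, Finset.card_univ, nsmul_eq_mul,
    mul_comm (Fintype.card ι : ℝ), Finset.mul_sum]

end prodExp

/-! ### What few adaptive queries can achieve -/

namespace ActiveLearner

/-- Two product distributions whose coordinates have Hellinger affinity at least `ρ` are hard to tell
apart from `q` adaptive queries: the affinity of any binary decision is at least `ρ ^ q`. -/
theorem pow_le_affinity {n : ℕ} {ρ : ℝ} (hρ : 0 ≤ ρ) (hρ1 : ρ ≤ 1) (D : Fin (n + 1) → Bool)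
    (T : ActiveLearner n) : ∀ (μ ν : Fin n → Bool → ℝ) (q : ℕ),
    (∀ i y, 0 ≤ μ i y) → (∀ i y, 0 ≤ ν i y) → (∀ i, ∑ y, μ i y = 1) → (∀ i, ∑ y, ν i y = 1) →
    (∀ i, ρ ≤ ∑ y, √(μ i y) * √(ν i y)) →
    (∀ Y : Fin n → Bool, (∀ i, μ i (Y i) ≠ 0) → T.queries Y ≤ q) →
    ρ ^ q ≤ ∑ s, √(prodExp μ (fun Y => if D (T.run Y) = s then 1 else 0)) *
      √(prodExp ν (fun Y => if D (T.run Y) = s then 1 else 0)) := by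
  induction T with
  | output h =>
    intro μ ν q _ _ hμ1 hν1 _ _
    refine (pow_le_one₀ hρ hρ1).trans_eq ?_
    have h1 : ∀ (κ : Fin n → Bool → ℝ) (s : Bool), (∀ i, ∑ z, κ i z = 1) →
        prodExp κ (fun Y => if D ((output h).run Y) = s then 1 else 0) =
          if D h = s then 1 else 0 := fun κ s hκ =>
      prodExp_const hκ (if D h = s then (1 : ℝ) else 0)
    simp only [h1 μ _ hμ1, h1 ν _ hν1, Fintype.sum_bool]
    by_cases hd : D h = true <;> simp [hd]
  | query i T₀ T₁ ih₀ ih₁ =>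
    intro μ ν q hμ hν hμ1 hν1 haff hq
    -- A labeling in the support of `μ`: the root query is made on it, so `q` is positive.
    obtain ⟨Y₀, hY₀⟩ : ∃ Y : Fin n → Bool, ∀ i, μ i (Y i) ≠ 0 := by
      have : ∀ i, ∃ y, μ i y ≠ 0 := by
        intro i
        by_contra! h
        have := hμ1 i
        simp [h] at this
      exact ⟨fun i => (this i).choose, fun i => (this i).choose_spec⟩
    obtain ⟨q, rfl⟩ : ∃ k, q = k + 1 := by
      have := hq Y₀ hY₀
      simp only [queries] at this
      exact ⟨q - 1, by omega⟩
    have hupd : ∀ (κ : Fin n → Bool → ℝ) (y : Bool), (∀ i y, 0 ≤ κ i y) →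
        ∀ j z, 0 ≤ Function.update κ i (Pi.single y 1) j z := by
      intro κ y hκ j z
      by_cases hj : j = i
      · subst hj
        rw [Function.update_self]
        by_cases hz : z = y <;> simp [hz]
      · rw [Function.update_of_ne hj]; exact hκ j z
    have hupd1 : ∀ (κ : Fin n → Bool → ℝ) (y : Bool), (∀ i, ∑ z, κ i z = 1) →
        ∀ j, ∑ z, Function.update κ i (Pi.single y 1) j z = 1 := by
      intro κ y hκ j
      by_cases hj : j = i
      · subst hj
        simp
      · rw [Function.update_of_ne hj]; exact hκ j
    set S : Bool → ActiveLearner n := fun y => if y then T₁ else T₀ with hS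
    set F : (Fin n → Bool → ℝ) → Bool → Bool → ℝ := fun κ y s =>
      prodExp (Function.update κ i (Pi.single y 1)) (fun Y => if D ((S y).run Y) = s then 1 else 0)
      with hF
    have hFnn : ∀ κ y s, (∀ i y, 0 ≤ κ i y) → 0 ≤ F κ y s := fun κ y s hκ =>
      prodExp_nonneg (hupd κ y hκ) (fun Y => by split_ifs <;> norm_num)
    have hsplit : ∀ (κ : Fin n → Bool → ℝ) (s : Bool),
        prodExp κ (fun Y => if D ((query i T₀ T₁).run Y) = s then 1 else 0) =
          ∑ y, κ i y * F κ y s := by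
      intro κ s
      refine prodExp_eq_sum_update i _ (fun y Y => if D ((S y).run Y) = s then 1 else 0) fun Y => ?_
      simp only [run, hS]
      by_cases hi : Y i = true <;> simp only [hi, if_true, if_false, Bool.false_eq_true]
    -- An answer of probability zero under `μ` is excluded: the query bound says nothing there, and
    -- its term vanishes below.
    have hchild : ∀ y, μ i y ≠ 0 → ρ ^ q ≤ ∑ s, √(F μ y s) * √(F ν y s) := by
      intro y hy
      have key : ∀ Y : Fin n → Bool,
          (∀ j, Function.update μ i (Pi.single y 1) j (Y j) ≠ 0) → (S y).queries Y ≤ q := by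
        intro Y hY
        have hi : Y i = y := by
          by_contra hne
          have := hY i
          rw [Function.update_self, Pi.single_eq_of_ne hne] at this
          exact this rfl
        have := hq Y (fun j => by
          by_cases hj : j = i
          · subst hj; rw [hi]; exact hy
          · have := hY j
            rwa [Function.update_of_ne hj] at this)
        simp only [queries, hi, hS] at this ⊢
        split_ifs at this ⊢ <;> omega
      have haff' : ∀ j, ρ ≤ ∑ z, √(Function.update μ i (Pi.single y 1) j z) *
          √(Function.update ν i (Pi.single y 1) j z) := by
        intro j
        by_cases hj : j = i
        · subst hj
          -- Once queried, the coordinate is the same point mass on both sides and has affinity 1.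
          rw [Function.update_self, Function.update_self]
          cases y <;> simpa using hρ1
        · rw [Function.update_of_ne hj, Function.update_of_ne hj]; exact haff j
      cases y
      · exact ih₀ _ _ q (hupd μ _ hμ) (hupd ν _ hν) (hupd1 μ _ hμ1) (hupd1 ν _ hν1) haff' key
      · exact ih₁ _ _ q (hupd μ _ hμ) (hupd ν _ hν) (hupd1 μ _ hμ1) (hupd1 ν _ hν1) haff' key
    simp only [hsplit]
    calc ρ ^ (q + 1) = ρ * ρ ^ q := by ring
      _ ≤ (∑ y, √(μ i y) * √(ν i y)) * ρ ^ q :=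
          mul_le_mul_of_nonneg_right (haff i) (pow_nonneg hρ q)
      _ = ∑ y, √(μ i y) * √(ν i y) * ρ ^ q := Finset.sum_mul _ _ _
      _ ≤ ∑ y, √(μ i y) * √(ν i y) * ∑ s, √(F μ y s) * √(F ν y s) := by
          refine Finset.sum_le_sum fun y _ => ?_
          by_cases hy : μ i y = 0
          · simp [hy]
          · exact mul_le_mul_of_nonneg_left (hchild y hy) (by positivity)
      _ = ∑ s, ∑ y, √(μ i y * F μ y s) * √(ν i y * F ν y s) := by
          rw [Finset.sum_comm]
          refine Finset.sum_congr rfl fun y _ => ?_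
          rw [Finset.mul_sum]
          refine Finset.sum_congr rfl fun s _ => ?_
          rw [Real.sqrt_mul (hμ i y), Real.sqrt_mul (hν i y)]
          ring
      -- Cauchy–Schwarz for each decision `s`: forgetting the answer `y` does not decrease affinity.
      _ ≤ _ := Finset.sum_le_sum fun s _ => Real.sum_sqrt_mul_sqrt_le _
          (fun y => mul_nonneg (hμ i y) (hFnn μ y s hμ))
          (fun y => mul_nonneg (hν i y) (hFnn ν y s hν))

/-- With at most `q` queries, at most `2 ^ q` different stumps can be returned. -/
theorem card_image_run_le {n : ℕ} (T : ActiveLearner n) : ∀ (S : Finset (Fin n → Bool)) (q : ℕ),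
    (∀ Y ∈ S, T.queries Y ≤ q) → (S.image T.run).card ≤ 2 ^ q := by
  induction T with
  | output h =>
    intro S q _
    have : S.image (output h).run ⊆ {h} := fun x hx => by
      obtain ⟨Y, _, rfl⟩ := Finset.mem_image.1 hx
      simp [run]
    exact (Finset.card_le_card this).trans (by simpa using Nat.one_le_two_pow)
  | query i T₀ T₁ ih₀ ih₁ =>
    intro S q hq
    rcases S.eq_empty_or_nonempty with rfl | ⟨Y₀, hY₀⟩
    · simp
    obtain ⟨q, rfl⟩ : ∃ k, q = k + 1 := by
      have := hq Y₀ hY₀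
      simp only [queries] at this
      exact ⟨q - 1, by omega⟩
    have hsub : S.image (query i T₀ T₁).run ⊆
        (S.filter fun Y => Y i = false).image T₀.run ∪
          (S.filter fun Y => Y i = true).image T₁.run := by
      intro x hx
      obtain ⟨Y, hY, rfl⟩ := Finset.mem_image.1 hx
      simp only [run]
      rcases h : Y i with _ | _
      · exact Finset.mem_union_left _
          (Finset.mem_image.2 ⟨Y, Finset.mem_filter.2 ⟨hY, h⟩, by simp⟩)
      · exact Finset.mem_union_right _
          (Finset.mem_image.2 ⟨Y, Finset.mem_filter.2 ⟨hY, h⟩, by simp⟩)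
    have h₀ := ih₀ (S.filter fun Y => Y i = false) q fun Y hY => by
      obtain ⟨hY, hi⟩ := Finset.mem_filter.1 hY
      have := hq Y hY
      simp only [queries, hi, Bool.false_eq_true, if_false] at this
      omega
    have h₁ := ih₁ (S.filter fun Y => Y i = true) q fun Y hY => by
      obtain ⟨hY, hi⟩ := Finset.mem_filter.1 hY
      have := hq Y hY
      simp only [queries, hi, if_true] at this
      omega
    have h2 := (Finset.card_le_card hsub).trans (Finset.card_union_le _ _)
    rw [pow_succ]
    omega

end ActiveLearner

/-! ### Stumps and their errors -/

theorem stump_eq_decide_le {n : ℕ} {X : Fin n → ℝ} (hX : StrictMono X) (h : Fin (n + 1))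
    (i : Fin n) : stump X h (X i) = decide (h.val ≤ i.val) := by
  unfold stump stumpThreshold
  by_cases hn : h.val < n
  · simp only [hn, dif_pos, EReal.coe_le_coe_iff, hX.le_iff_le, Fin.le_def]
  · have : ¬ h.val ≤ i.val := by omega
    simp [hn, this]

theorem stumpErr_sub {n : ℕ} (X : Fin n → ℝ) (Y : Fin n → Bool) (ε : ℝ) (h h' : Fin (n + 1)) :
    stumpErr X Y h - (1 + ε) * stumpErr X Y h' = (1 / (n : ℝ)) * ∑ i : Fin n,
      ((if stump X h (X i) ≠ Y i then (1 : ℝ) else 0) -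
        (1 + ε) * if stump X h' (X i) ≠ Y i then (1 : ℝ) else 0) := by
  unfold stumpErr
  rw [Finset.sum_sub_distrib, ← Finset.mul_sum]
  ring

/-- Some stump assigns the label `b` to all data points. -/
theorem exists_stump_eq_const {n : ℕ} {X : Fin n → ℝ} (hX : StrictMono X) (b : Bool) :
    ∃ h : Fin (n + 1), ∀ i, stump X h (X i) = b := by
  cases b
  · refine ⟨Fin.last n, fun i => ?_⟩
    rw [stump_eq_decide_le hX]
    simp
  · refine ⟨0, fun i => ?_⟩
    rw [stump_eq_decide_le hX]
    simp

/-- The stump with index `h` is the only approximate one for its own labels. -/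
theorem eq_of_isApproxStump {n : ℕ} {X : Fin n → ℝ} (hX : StrictMono X) {ε : ℝ} {h k : Fin (n + 1)}
    (hk : IsApproxStump X (fun i => decide (h.val ≤ i.val)) ε k) : k = h := by
  have h1 := sub_nonpos.2 (hk h)
  rw [stumpErr_sub] at h1
  simp only [stump_eq_decide_le hX, ne_eq, not_true_eq_false, if_false, mul_zero, sub_zero] at h1
  by_contra hne
  have hne' : k.val ≠ h.val := fun e => hne (Fin.ext e)
  have hn : 0 < n := by omega
  have hi : ∃ i : Fin n, ¬ (decide (k.val ≤ i.val) = decide (h.val ≤ i.val)) := by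
    -- The smaller of the two indices is a data point where the stumps differ.
    rcases lt_or_gt_of_ne hne' with hlt | hlt
    · exact ⟨⟨k.val, by omega⟩, by simpa using hlt⟩
    · exact ⟨⟨h.val, by omega⟩, by simpa using hlt⟩
  obtain ⟨i, hi⟩ := hi
  have h2 : (0 : ℝ) < ∑ i : Fin n,
      if ¬ decide (k.val ≤ i.val) = decide (h.val ≤ i.val) then (1 : ℝ) else 0 :=
    Finset.sum_pos' (fun i _ => by split_ifs <;> norm_num)
      ⟨i, Finset.mem_univ i, by rw [if_pos hi]; norm_num⟩
  have h3 : (0 : ℝ) < 1 / n := by positivity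
  exact absurd h1 (not_le.2 (mul_pos h3 h2))

/-! ### Derandomization and the counting bound -/

/-- A randomized learner that never makes `m` queries can be derandomized: for every weighting of
finitely many labelings, some deterministic learner making fewer than `m` queries fails with less
than the fraction `δ` of the total weight. -/
theorem exists_learner_of_learnsStump {n : ℕ} {X : Fin n → ℝ} {ε δ m : ℝ}
    {A : Measure (ActiveLearner n)} [IsProbabilityMeasure A] (hA : LearnsStump X ε δ A)
    (hm : ∀ Y : Fin n → Bool, A {T | m ≤ (T.queries Y : ℝ)} = 0)
    {κ : Type*} (s : Finset κ) (w : κ → ℝ) (hw : ∀ k ∈ s, 0 ≤ w k) (hw' : 0 < ∑ k ∈ s, w k)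
    (L : κ → Fin n → Bool) :
    ∃ T : ActiveLearner n, (∀ Y, (T.queries Y : ℝ) < m) ∧
      (∑ k ∈ s, w k * open Classical in if IsApproxStump X (L k) ε (T.run (L k)) then 0 else 1) <
        δ * ∑ k ∈ s, w k := by
  classical
  have hmeas : ∀ B : Set (ActiveLearner n), MeasurableSet B := fun B => trivial
  set N : Set (ActiveLearner n) := ⋃ Y : Fin n → Bool, {T | m ≤ (T.queries Y : ℝ)} with hN
  have hN0 : A N = 0 := measure_iUnion_null hm
  set B : κ → Set (ActiveLearner n) := fun k => {T | IsApproxStump X (L k) ε (T.run (L k))}ᶜ with hB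
  have hint : ∀ k ∈ s, Integrable (fun T => w k * (B k).indicator 1 T) A := fun k _ =>
    ((integrable_indicator_iff (hmeas _)).2 (integrable_const (1 : ℝ)).integrableOn).const_mul _
  -- Outside the null set of learners making too many queries, some learner has failure weight at
  -- most the average.
  obtain ⟨T, hT, hle⟩ := exists_notMem_null_le_integral (integrable_finsetSum s hint) hN0
  rw [integral_finsetSum s hint] at hle
  refine ⟨T, fun Y => ?_, ?_⟩
  · simp only [hN, Set.mem_iUnion, Set.mem_ofPred_eq, not_exists, not_le] at hT
    exact hT Y
  · have h1 : ∀ k, ∫ T, w k * (B k).indicator 1 T ∂A = w k * A.real (B k) := fun k => by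
      rw [integral_const_mul, integral_indicator_one (hmeas _)]
    have h2 : ∀ k, A.real (B k) < δ := fun k => by
      rw [hB, probReal_compl_eq_one_sub (hmeas _)]
      linarith [hA (L k)]
    have h3 : ∑ k ∈ s, w k * A.real (B k) < δ * ∑ k ∈ s, w k := by
      obtain ⟨k, hk, hk0⟩ := Finset.exists_lt_of_sum_lt (s := s) (f := fun _ => (0 : ℝ)) (g := w)
        (by simpa using hw')
      rw [Finset.mul_sum]
      refine Finset.sum_lt_sum (fun j hj => ?_) ⟨k, hk, ?_⟩
      · rw [mul_comm δ]; exact mul_le_mul_of_nonneg_left (h2 j).le (hw j hj)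
      · rw [mul_comm δ]; exact mul_lt_mul_of_pos_left (h2 k) hk0
    simp only [h1] at hle
    refine lt_of_le_of_lt (le_trans (le_of_eq ?_) hle) h3
    refine Finset.sum_congr rfl fun k _ => ?_
    by_cases hk : IsApproxStump X (L k) ε (T.run (L k)) <;> simp [hB, hk]

/-- Already the labels of the `n + 1` stumps force arbitrarily many queries as `n` grows. -/
theorem stumpLearningRequires_of_two_pow_le {n : ℕ} {ε δ m : ℝ}
    (hn : 2 ^ ⌊m⌋₊ ≤ (n + 1) * (1 - δ)) : StumpLearningRequires n ε δ m := by
  classical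
  intro X hX A _ hA
  by_contra! hm
  obtain ⟨T, hq, hT⟩ := exists_learner_of_learnsStump hA (fun Y => le_zero_iff.1 (hm Y))
    (Finset.univ : Finset (Fin (n + 1))) (fun _ => 1) (by simp) (by simp; positivity)
    (fun h i => decide (h.val ≤ i.val))
  have hcard := T.card_image_run_le Finset.univ ⌊m⌋₊ fun Y _ => Nat.le_floor (hq Y).le
  set G : Finset (Fin (n + 1)) := Finset.univ.filter fun h =>
    IsApproxStump X (fun i => decide (h.val ≤ i.val)) ε
      (T.run fun i => decide (h.val ≤ i.val)) with hG
  have hsub : G ⊆ Finset.univ.image T.run := fun h hh =>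
    Finset.mem_image.2 ⟨_, Finset.mem_univ _, eq_of_isApproxStump hX (Finset.mem_filter.1 hh).2⟩
  have h1 : (G.card : ℝ) ≤ 2 ^ ⌊m⌋₊ := by exact_mod_cast (Finset.card_le_card hsub).trans hcard
  have h2 : (∑ h : Fin (n + 1), (1 : ℝ) * if IsApproxStump X (fun i => decide (h.val ≤ i.val)) ε
      (T.run fun i => decide (h.val ≤ i.val)) then (0 : ℝ) else 1) = (n + 1) - G.card := by
    have h3 : (G.card : ℝ) = ∑ h : Fin (n + 1),
        if IsApproxStump X (fun i => decide (h.val ≤ i.val)) ε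
          (T.run fun i => decide (h.val ≤ i.val)) then (1 : ℝ) else 0 := by
      rw [hG, Finset.card_filter]; push_cast; rfl
    have h4 : ((n : ℝ) + 1) = ∑ h : Fin (n + 1), (1 : ℝ) := by simp
    rw [h3, h4, ← Finset.sum_sub_distrib]
    refine Finset.sum_congr rfl fun h _ => ?_
    split_ifs <;> norm_num
  rw [h2] at hT
  simp only [Finset.sum_const, Finset.card_univ, Fintype.card_fin, nsmul_eq_mul, mul_one] at hT
  push_cast at hT
  linarith

/-! ### Biased labels -/

/-- The weights of a random label that is `b` with probability `p`. -/
def biasedLabel (b : Bool) (p : ℝ) (y : Bool) : ℝ := if y = b then p else 1 - p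

theorem biasedLabel_nonneg {p : ℝ} (hp : 0 ≤ p) (hp1 : p ≤ 1) (b y : Bool) :
    0 ≤ biasedLabel b p y := by
  unfold biasedLabel; split_ifs <;> linarith

theorem sum_biasedLabel (b : Bool) (p : ℝ) : ∑ y, biasedLabel b p y = 1 := by
  cases b <;> simp [biasedLabel]

theorem affinity_biasedLabel (p : ℝ) :
    ∑ y, √(biasedLabel true p y) * √(biasedLabel false p y) = 2 * (√p * √(1 - p)) := by
  simp [biasedLabel]
  ring

/-- When most labels are `b`, a stump that disagrees with `b` on half of the data points is unlikely
to be approximate. -/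
theorem prodExp_isApproxStump_le {n : ℕ} (hn : 0 < n) {X : Fin n → ℝ} (hX : StrictMono X) {ε : ℝ}
    (hε : 0 < ε) (hε1 : ε ≤ 1) {γ : ℝ} (hγ : γ * (1 + ε) = 3 / 4 * ε) (b : Bool) (h : Fin (n + 1))
    (hh : (n : ℝ) ≤ 2 * ∑ i : Fin n, if stump X h (X i) = b then (0 : ℝ) else 1) :
    prodExp (fun _ : Fin n => biasedLabel b (1 / 2 + γ))
      (fun Y => open Classical in if IsApproxStump X Y ε h then 1 else 0) ≤
        Real.exp (-(n * ε ^ 2 / 256)) := by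
  classical
  have hγ0 : 0 < γ := by
    by_contra! hc
    nlinarith
  have hγ1 : γ ≤ 3 / 8 := by nlinarith
  obtain ⟨k, hk⟩ := exists_stump_eq_const hX b
  -- The contribution of one point to `n` times the error of `h` minus `1 + ε` times that of the
  -- constant stump `b`; if `h` is approximate, the sum is nonpositive.
  set v : Fin n → Bool → ℝ := fun i y => (if stump X h (X i) ≠ y then (1 : ℝ) else 0) -
    (1 + ε) * if b ≠ y then (1 : ℝ) else 0 with hv
  have hv2 : ∀ i y, |v i y| ≤ 2 := by
    intro i y
    simp only [hv]
    split_ifs <;> rw [abs_le] <;> constructor <;> linarith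
  have hnn : ∀ (i : Fin n) y, 0 ≤ biasedLabel b (1 / 2 + γ) y := fun _ y =>
    biasedLabel_nonneg (by linarith) (by linarith) b y
  have hmean : ∀ i, ∑ y, biasedLabel b (1 / 2 + γ) y * v i y =
      2 * γ * (if stump X h (X i) = b then (0 : ℝ) else 1) - ε * (1 / 2 - γ) := by
    intro i
    rcases hs : stump X h (X i) with _ | _ <;> cases b <;>
      simp [biasedLabel, hv, hs] <;> ring
  -- The mean sum is at least `n * ε / 4`, so `l = ε / 32` minimizes the exponent `4 * l ^ 2 * n - l
  -- * n * ε / 4`.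
  refine (prodExp_mono hnn fun Y => ?_).trans
    ((prodExp_sum_nonpos_le hnn (fun _ => sum_biasedLabel b _) v hv2 (l := ε / 32)
      (by positivity) (by linarith)).trans ?_)
  · by_cases hY : IsApproxStump X Y ε h
    · have h1 := sub_nonpos.2 (hY k)
      rw [stumpErr_sub] at h1
      simp only [hk] at h1
      have hn' : (0 : ℝ) < 1 / n := by positivity
      have h2 : ∑ i, v i (Y i) ≤ 0 := nonpos_of_mul_nonpos_right h1 hn'
      rw [if_pos hY, if_pos h2]
    · rw [if_neg hY]
      split_ifs <;> norm_num
  · simp only [hmean]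
    rw [Finset.sum_sub_distrib, ← Finset.mul_sum, Finset.sum_const, Finset.card_univ,
      Fintype.card_fin, nsmul_eq_mul]
    refine Real.exp_le_exp.2 ?_
    set d := ∑ i : Fin n, if stump X h (X i) = b then (0 : ℝ) else 1
    have h3 : n * ε / 4 ≤ 2 * γ * d - n * (ε * (1 / 2 - γ)) := by
      have h4 := mul_le_mul_of_nonneg_left hh hγ0.le
      have h5 : (n : ℝ) * (γ * (1 + ε)) = n * (3 / 4 * ε) := by rw [hγ]
      linarith
    nlinarith [mul_le_mul_of_nonneg_left h3 hε.le]

/-! ### Numerical estimates -/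

/-- The affinity `√(a b) + √((1 - a) (1 - b))` of two distributions of a binary decision is small
when both errors `a` and `1 - b` are small. -/
theorem sq_affinity_le {a b M : ℝ} (ha : 0 ≤ a) (ha1 : a ≤ 1) (hb : 0 ≤ b) (hb1 : b ≤ 1)
    (hM : a + (1 - b) ≤ M) (hM1 : M ≤ 1) :
    (√a * √b + √(1 - a) * √(1 - b)) ^ 2 ≤ M * (2 - M) := by
  have h1 := Real.sq_sqrt ha
  have h2 := Real.sq_sqrt hb
  have h3 := Real.sq_sqrt (sub_nonneg.2 ha1)
  have h4 := Real.sq_sqrt (sub_nonneg.2 hb1)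
  have h5 : (√a * √b + √(1 - a) * √(1 - b)) ^ 2 ≤ (a + (1 - b)) * (b + (1 - a)) := by
    -- Cauchy–Schwarz for `(√a, √(1 - b))` and `(√b, √(1 - a))`; the right side is `t * (2 - t)`
    -- with `t = a + (1 - b)`, increasing for `t ≤ 1`.
    nlinarith [sq_nonneg (√a * √(1 - a) - √b * √(1 - b))]
  nlinarith

/-- With `x = n * ε ^ 2`, half of `exp (-x / 256)` absorbs the factor `x` and the other half is at
most `(ε * δ) ^ 8`, because `4096 = 8 * 512`. Six of these powers pay for constants, two for `ε ^ 2`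
and `δ`. -/
theorem union_bound_le {n : ℕ} {ε δ : ℝ} (hε : 0 < ε) (hε1 : ε ≤ 1) (hδ : 0 < δ) (hδ1 : δ ≤ 1 / 4)
    (hn : 4096 * (Real.log (1 / (ε * δ)) / ε ^ 2) ≤ n) :
    0 < n ∧ (n + 1) * Real.exp (-(n * ε ^ 2 / 256)) ≤ δ / 4 := by
  have hu : 0 < ε * δ := by positivity
  have hu1 : ε * δ ≤ 1 / 4 := by nlinarith
  have hL : 0 < Real.log (1 / (ε * δ)) :=
    Real.log_pos (by rw [lt_div_iff₀ hu]; linarith)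
  have hn0 : (0 : ℝ) < n := lt_of_lt_of_le (by positivity) hn
  have hn0' : 0 < n := by exact_mod_cast hn0
  refine ⟨hn0', ?_⟩
  have hn1 : (1 : ℝ) ≤ n := by exact_mod_cast hn0'
  have hx : 4096 * Real.log (1 / (ε * δ)) ≤ n * ε ^ 2 := by
    rwa [← mul_div_assoc, div_le_iff₀ (by positivity)] at hn
  set x := (n : ℝ) * ε ^ 2 with hxdef
  have h1 : x ≤ 512 * Real.exp (x / 512) := by
    linarith [Real.add_one_le_exp (x / 512)]
  have h2 : Real.exp (-(x / 512)) ≤ (ε * δ) ^ 8 := by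
    have : (ε * δ) ^ 8 = Real.exp (-(8 * Real.log (1 / (ε * δ)))) := by
      rw [one_div, Real.log_inv, mul_neg, neg_neg, ← Real.exp_log (pow_pos hu 8), Real.log_pow]
      norm_num
    rw [this]
    exact Real.exp_le_exp.2 (by linarith)
  have h3 : x * Real.exp (-(x / 256)) ≤ 512 * (ε * δ) ^ 8 := by
    have h4 : Real.exp (-(x / 256)) = Real.exp (-(x / 512)) * Real.exp (-(x / 512)) := by
      rw [← Real.exp_add]; ring_nf
    have h5 : Real.exp (x / 512) * Real.exp (-(x / 512)) = 1 := by
      rw [← Real.exp_add]; simp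
    have h6 := Real.exp_pos (-(x / 512))
    calc x * Real.exp (-(x / 256))
        ≤ 512 * Real.exp (x / 512) * Real.exp (-(x / 256)) :=
          mul_le_mul_of_nonneg_right h1 (Real.exp_pos _).le
      _ = 512 * (Real.exp (x / 512) * Real.exp (-(x / 512))) * Real.exp (-(x / 512)) := by
          rw [h4]; ring
      _ ≤ _ := by rw [h5]; linarith
  have h7 : (ε * δ) ^ 6 ≤ (1 / 4) ^ 6 := pow_le_pow_left₀ hu.le hu1 6
  have h8 : ε ^ 2 * ((n + 1) * Real.exp (-(x / 256))) ≤ ε ^ 2 * (δ / 4) := by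
    calc ε ^ 2 * ((n + 1) * Real.exp (-(x / 256)))
        ≤ ε ^ 2 * ((2 * n) * Real.exp (-(x / 256))) := by
          gcongr; linarith
      _ = 2 * (x * Real.exp (-(x / 256))) := by rw [hxdef]; ring
      _ ≤ 2 * (512 * ((ε * δ) ^ 6 * (ε * δ) ^ 2)) := by
          have : (ε * δ) ^ 8 = (ε * δ) ^ 6 * (ε * δ) ^ 2 := by ring
          rw [← this]; linarith
      _ ≤ 2 * (512 * ((1 / 4) ^ 6 * (ε * δ) ^ 2)) := by gcongr
      _ = ε ^ 2 * (δ * δ / 4) := by ring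
      _ ≤ ε ^ 2 * (δ / 4) := by gcongr; nlinarith
  exact le_of_mul_le_mul_left h8 (by positivity)

/-- For `δ ≤ 1 / 16` the argument is at most `8 * δ ≤ δ ^ (1 / 4)`. For larger `δ` it is at most `55
/ 64`, while `log (1 / δ)` is bounded. -/
theorem log_affinity_bound {δ : ℝ} (hδ : 0 < δ) (hδ1 : δ ≤ 1 / 4) :
    Real.log (5 / 2 * δ * (2 - 5 / 2 * δ)) ≤ -(Real.log (1 / δ) / 32) := by
  have hlog4 : Real.log 4 ≤ 7 / 5 := by
    rw [show (4 : ℝ) = 2 ^ 2 by norm_num, Real.log_pow]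
    have := Real.log_two_lt_d9
    push_cast; linarith
  have hpos : 0 < 5 / 2 * δ * (2 - 5 / 2 * δ) := by
    apply mul_pos <;> linarith
  rw [one_div, Real.log_inv]
  rcases le_or_gt δ (1 / 16) with h | h
  · have h1 : Real.log (5 / 2 * δ * (2 - 5 / 2 * δ)) ≤ Real.log (8 * δ) :=
      Real.log_le_log hpos (by nlinarith)
    have h2 : Real.log (8 * δ) = 3 * Real.log 2 + Real.log δ := by
      rw [Real.log_mul (by norm_num) hδ.ne', show (8 : ℝ) = 2 ^ 3 by norm_num, Real.log_pow]
      push_cast; ring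
    have h3 : Real.log δ ≤ -(4 * Real.log 2) := by
      have := Real.log_le_log hδ h
      rw [show (1 / 16 : ℝ) = (2 ^ 4)⁻¹ by norm_num, Real.log_inv, Real.log_pow] at this
      push_cast at this; exact this
    have h4 := Real.log_pos one_lt_two
    linarith
  · have h1 : Real.log (5 / 2 * δ * (2 - 5 / 2 * δ)) ≤ 5 / 2 * δ * (2 - 5 / 2 * δ) - 1 :=
      Real.log_le_sub_one_of_pos hpos
    have h2 : 5 / 2 * δ * (2 - 5 / 2 * δ) ≤ 55 / 64 := by nlinarith
    have h3 : -(2 * Real.log 4) ≤ Real.log δ := by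
      have := Real.log_le_log (by norm_num) h.le
      rw [show (1 / 16 : ℝ) = (4 ^ 2)⁻¹ by norm_num, Real.log_inv, Real.log_pow] at this
      push_cast at this; exact this
    linarith

theorem neg_le_log_one_sub {γ : ℝ} (hγ : 0 ≤ γ) (hγ1 : γ ≤ 3 / 8) :
    -(12 * γ ^ 2) ≤ Real.log (1 - 4 * γ ^ 2) := by
  have hsq : γ ^ 2 ≤ 9 / 64 := by nlinarith
  have ht : 0 < 1 - 4 * γ ^ 2 := by linarith
  refine le_trans ?_ (Real.one_sub_inv_le_log_of_pos ht)
  have : (1 - 4 * γ ^ 2)⁻¹ ≤ 1 + 12 * γ ^ 2 := by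
    rw [inv_le_iff_one_le_mul₀ ht]
    nlinarith [mul_nonneg (sq_nonneg γ) (sub_nonneg.2 hsq), sq_nonneg γ]
  linarith

/-! ### The test of the hidden bit -/

/-- The main lower bound: for labels that are independently `b` with probability slightly above
`1 / 2`, an approximate stump reveals `b`, which takes `log (1 / δ) / ε ^ 2` labels. -/
theorem stumpLearningRequires_of_log_le {n : ℕ} {ε δ : ℝ} (hε : 0 < ε) (hε1 : ε ≤ 1) (hδ : 0 < δ)
    (hδ1 : δ ≤ 1 / 4) (hn : 4096 * (Real.log (1 / (ε * δ)) / ε ^ 2) ≤ n) :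
    StumpLearningRequires n ε δ (1 / 300 * (Real.log (1 / δ) / ε ^ 2)) := by
  classical
  obtain ⟨hn0, hη⟩ := union_bound_le hε hε1 hδ hδ1 hn
  intro X hX A _ hA
  by_contra! hm
  set m := 1 / 300 * (Real.log (1 / δ) / ε ^ 2) with hmdef
  have hL : 0 < Real.log (1 / δ) := Real.log_pos (by rw [lt_div_iff₀ hδ]; linarith)
  set γ := 3 / 4 * ε / (1 + ε) with hγdef
  have hγ : γ * (1 + ε) = 3 / 4 * ε := by rw [hγdef]; field_simp
  have hγ0 : 0 < γ := by positivity
  have hγ1 : γ ≤ 3 / 8 := by nlinarith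
  have hγε : γ ≤ 3 / 4 * ε := by nlinarith
  set p := 1 / 2 + γ with hp
  set P : Bool → Fin n → Bool → ℝ := fun b _ => biasedLabel b p with hP
  have hP0 : ∀ b i y, 0 ≤ P b i y := fun b i y => biasedLabel_nonneg (by linarith) (by linarith) b y
  have hP1 : ∀ b i, ∑ y, P b i y = 1 := fun b i => sum_biasedLabel b p
  have htot : ∀ b, ∑ Y : Fin n → Bool, ∏ i, P b i (Y i) = 1 := fun b => by
    simpa [prodExp] using prodExp_const (hP1 b) 1
  have htot2 : ∑ k : Bool × (Fin n → Bool), ∏ i, P k.1 i (k.2 i) = 2 := by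
    rw [Fintype.sum_prod_type]
    simp only [htot, Fintype.sum_bool]; norm_num
  -- The weights put mass 1 on each value of `b`, so the two failure probabilities add up to less
  -- than `2 * δ`.
  obtain ⟨T, hq, hT⟩ := exists_learner_of_learnsStump hA (fun Y => le_zero_iff.1 (hm Y))
    (Finset.univ : Finset (Bool × (Fin n → Bool))) (fun k => ∏ i, P k.1 i (k.2 i))
    (fun k _ => Finset.prod_nonneg fun i _ => hP0 k.1 i (k.2 i)) (by rw [htot2]; norm_num) (fun k => k.2)
  rw [htot2, Fintype.sum_prod_type, Fintype.sum_bool] at hT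
  set fail : (Fin n → Bool) → ℝ := fun Y => if IsApproxStump X Y ε (T.run Y) then 0 else 1
    with hfail
  have hT' : prodExp (P true) fail + prodExp (P false) fail < 2 * δ := by
    rw [mul_comm]; exact hT
  set dis : Bool → Fin (n + 1) → ℝ := fun b h =>
    ∑ i : Fin n, if stump X h (X i) = b then (0 : ℝ) else 1 with hdis
  have hdis2 : ∀ h, dis true h + dis false h = n := by
    intro h
    simp only [hdis]
    rw [← Finset.sum_add_distrib, Finset.sum_congr rfl (g := fun _ => (1 : ℝ))]
    · simp
    · intro i _
      cases stump X h (X i) <;> simp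
  -- `D h` is a label with which `h` disagrees on at least half of the points, so under `P b` the
  -- erroneous decision is `b` itself.
  set D : Fin (n + 1) → Bool := fun h => decide ((n : ℝ) ≤ 2 * dis true h) with hD
  -- the decision `D` is wrong only if the learner fails or a bad stump is approximate
  have herr : ∀ b, prodExp (P b) (fun Y => if D (T.run Y) = b then 1 else 0) ≤
      prodExp (P b) fail + δ / 4 := by
    intro b
    set bad : Fin (n + 1) → (Fin n → Bool) → ℝ := fun h Y =>
      if (n : ℝ) ≤ 2 * dis b h then (if IsApproxStump X Y ε h then 1 else 0) else 0 with hbad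
    have hbad0 : ∀ h Y, 0 ≤ bad h Y := fun h Y => by
      simp only [hbad]; split_ifs <;> norm_num
    have h1 : ∀ Y, (if D (T.run Y) = b then (1 : ℝ) else 0) ≤ fail Y + ∑ h, bad h Y := by
      intro Y
      have hs := Finset.single_le_sum (f := fun h => bad h Y) (fun h _ => hbad0 h Y)
        (Finset.mem_univ (T.run Y))
      have hs0 := (hbad0 (T.run Y) Y)
      by_cases hDb : D (T.run Y) = b
      · rw [if_pos hDb]
        by_cases hap : IsApproxStump X Y ε (T.run Y)
        · have hd : (n : ℝ) ≤ 2 * dis b (T.run Y) := by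
            cases b
            · have : ¬ (n : ℝ) ≤ 2 * dis true (T.run Y) := by simpa [hD] using hDb
              linarith [hdis2 (T.run Y)]
            · simpa [hD] using hDb
          have h2 : bad (T.run Y) Y = 1 := by simp only [hbad]; rw [if_pos hd, if_pos hap]
          have h3 : fail Y = 0 := by simp only [hfail]; rw [if_pos hap]
          linarith
        · have h3 : fail Y = 1 := by simp only [hfail]; rw [if_neg hap]
          linarith
      · rw [if_neg hDb]
        have : 0 ≤ fail Y := by simp only [hfail]; split_ifs <;> norm_num
        linarith
    refine (prodExp_mono (hP0 b) h1).trans ?_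
    rw [prodExp_add, prodExp_sum]
    have h4 : ∀ h, prodExp (P b) (bad h) ≤ Real.exp (-(n * ε ^ 2 / 256)) := by
      intro h
      by_cases hh : (n : ℝ) ≤ 2 * dis b h
      · simp only [hbad, if_pos hh]
        exact prodExp_isApproxStump_le hn0 hX hε hε1 hγ b h hh
      · simp only [hbad, if_neg hh]
        rw [prodExp_const (hP1 b)]
        positivity
    have h5 := Finset.sum_le_sum fun h (_ : h ∈ (Finset.univ : Finset (Fin (n + 1)))) => h4 h
    rw [Finset.sum_const, Finset.card_univ, Fintype.card_fin, nsmul_eq_mul] at h5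
    push_cast at h5
    linarith
  set F : Bool → Bool → ℝ := fun b s =>
    prodExp (P b) (fun Y => if D (T.run Y) = s then 1 else 0) with hF
  have hF0 : ∀ b s, 0 ≤ F b s := fun b s =>
    prodExp_nonneg (hP0 b) fun Y => by split_ifs <;> norm_num
  have hF1 : ∀ b, F b true + F b false = 1 := by
    intro b
    simp only [hF]
    rw [← prodExp_add]
    refine Eq.trans (congrArg _ (funext fun Y => ?_)) (prodExp_const (hP1 b) 1)
    cases D (T.run Y) <;> simp
  have haff := T.pow_le_affinity (ρ := 2 * (√p * √(1 - p))) (by positivity) (by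
      nlinarith [sq_nonneg (√p - √(1 - p)), Real.sq_sqrt (show 0 ≤ p by linarith),
        Real.sq_sqrt (show 0 ≤ 1 - p by linarith)]) D (P true) (P false) ⌊m⌋₊ (hP0 true) (hP0 false)
    (hP1 true) (hP1 false) (fun _ => (affinity_biasedLabel p).ge) (fun Y _ => Nat.le_floor (hq Y).le)
  rw [Fintype.sum_bool] at haff
  change _ ≤ √(F true true) * √(F false true) + √(F true false) * √(F false false) at haff
  rw [show F true false = 1 - F true true by linarith [hF1 true],
    show F false false = 1 - F false true by linarith [hF1 false]] at haff
  -- `5 / 2 * δ` is `2 * δ` for failures plus `δ / 4` from the union bound for each `b`.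
  have hsq := sq_affinity_le (M := 5 / 2 * δ) (hF0 true true)
    (by linarith [hF1 true, hF0 true false]) (hF0 false true)
    (by linarith [hF1 false, hF0 false false])
    (by
      have e1 : F true true ≤ _ := herr true
      have e2 : F false false ≤ _ := herr false
      linarith [hF1 false]) (by linarith)
  have hpow : (1 - 4 * γ ^ 2) ^ ⌊m⌋₊ ≤ 5 / 2 * δ * (2 - 5 / 2 * δ) := by
    refine le_trans (le_of_eq ?_) ((pow_le_pow_left₀ (by positivity) haff 2).trans hsq)
    rw [← pow_mul, mul_comm ⌊m⌋₊ 2, pow_mul]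
    congr 1
    rw [mul_pow, mul_pow, Real.sq_sqrt (by linarith), Real.sq_sqrt (by linarith), hp]
    ring
  have hlog := (Real.log_le_log (pow_pos (by nlinarith) _) hpow).trans (log_affinity_bound hδ hδ1)
  rw [Real.log_pow] at hlog
  have h1 := neg_le_log_one_sub hγ0.le hγ1
  have h2 : 12 * γ ^ 2 ≤ 7 * ε ^ 2 := by
    have := pow_le_pow_left₀ hγ0.le hγε 2
    linarith [mul_pow (3 / 4) ε 2, sq_nonneg ε]
  have h3 : -(m * (7 * ε ^ 2)) ≤ ⌊m⌋₊ * Real.log (1 - 4 * γ ^ 2) := by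
    have h4 := mul_le_mul_of_nonneg_right (Nat.floor_le (show 0 ≤ m by positivity))
      (show 0 ≤ 7 * ε ^ 2 by positivity)
    have h5 := mul_le_mul_of_nonneg_left ((neg_le_neg h2).trans h1)
      (Nat.cast_nonneg (α := ℝ) ⌊m⌋₊)
    linarith
  -- The constant `1 / 300` works because `7 / 300 < 1 / 32`, the factor in `log_affinity_bound`.
  have h6 : m * (7 * ε ^ 2) = 7 / 300 * Real.log (1 / δ) := by
    rw [hmdef]; field_simp
  linarith

theorem mainTheorem5 :
    ∃ c : ℝ, 0 < c ∧
      (∀ ε δ : ℝ, 0 < ε → 0 < δ → δ < 1 →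
        ∃ N : ℕ, ∀ n : ℕ, N ≤ n →
          StumpLearningRequires n ε δ (c * (Real.log (1 / δ) / ε ^ 2))) ∧
      (∃ C : ℝ, 0 < C ∧
        ∀ ε δ : ℝ, 0 < ε → ε ≤ 1 → 0 < δ → δ ≤ 1 / 4 →
          ∀ n : ℕ, C * (Real.log (1 / (ε * δ)) / ε ^ 2) ≤ (n : ℝ) →
            StumpLearningRequires n ε δ (c * (Real.log (1 / δ) / ε ^ 2))) := by
  refine ⟨1 / 300, by norm_num, fun ε δ _ _ hδ1 => ?_, 4096, by norm_num,
    fun ε δ hε hε1 hδ hδ1 n hn => stumpLearningRequires_of_log_le hε hε1 hδ hδ1 hn⟩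
  set m := 1 / 300 * (Real.log (1 / δ) / ε ^ 2)
  -- For fixed `ε` and `δ` the target `m` is a constant, so the counting bound applies as soon as
  -- `n` is this large.
  obtain ⟨N, hN⟩ := exists_nat_ge (2 ^ ⌊m⌋₊ / (1 - δ))
  refine ⟨N, fun n hn => stumpLearningRequires_of_two_pow_le ?_⟩
  rw [div_le_iff₀ (by linarith)] at hN
  have : (N : ℝ) ≤ n := by exact_mod_cast hn
  nlinarith
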